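/- Let $(E,d)$ be a non-empty complete separable metric space whose distance $d$ is bounded by $1$, equipped with its Borel $\sigma$-algebra, and let $P$ be a Markov kernel on $E$. Let $Q$ be a coupling kernel for $P$, i.e. a Markov kernel on $E\times E$ such that for all $x,y\in E$ the marginals of $Q((x,y),\cdot)$ are $P(x,\cdot)$ and $P(y,\cdot)$. Let $\Delta\subseteq E\times E$ be measurable, $\ell\ge 1$ an integer and $\varepsilon>0$, and assume: (A1) $Qd(x,y)\le d(x,y)$ for all $x,y\in E$, and $Q^{\ell}d(x,y)\le(1-\varepsilon)\,d(x,y)$ for all $(x,y)\in\Delta$. (A2) There are a concave increasing function $\phi:[0,\infty)\to[0,\infty)$ with $\lim_{t\to\infty}\phi(t)=\infty$, a measurable function $V:E\to[1,\infty)$ and a constant $b\in\mathbb R$ such that for all $x,y\in E$ $$PV(x)+PV(y)\le V(x)+V(y)-\phi\big(V(x)+V(y)\big)+b\,\mathbf 1_{\Delta}(x,y),$$ and $\sup_{(x,y)\in\Delta}\{V(x)+V(y)\}<\infty$. Then $P$ admits a unique invariant probability measure $\pi$, and $\int_E\phi(V(x))\,\pi(\mathrm dx)<\infty$. -/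

import Mathlib

open MeasureTheory ProbabilityTheory Filter

/-- `Q` is a coupling kernel for the Markov kernel `P`: a Markov kernel on the product space such
that, for all `x, y`, the probability `Q((x, y), ·)` has marginals `P(x, ·)` and `P(y, ·)`. -/
structure IsCouplingKernel {E : Type*} [MeasurableSpace E]
    (P : Kernel E E) (Q : Kernel (E × E) (E × E)) : Prop where
  isMarkovKernel : IsMarkovKernel Q
  map_fst : ∀ x y : E, (Q (x, y)).map Prod.fst = P x
  map_snd : ∀ x y : E, (Q (x, y)).map Prod.snd = P y

/-- The contraction condition on a coupling kernel `Q`: `Q d ≤ d` everywhere, and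
`Q^ℓ d ≤ (1 - ε) d` on the measurable set `Δ`, with `ℓ ≥ 1` and `ε > 0`.
(The power of a kernel is its iterate for composition.) -/
structure ContractionCondition {E : Type*} [MetricSpace E] [MeasurableSpace E]
    (Q : Kernel (E × E) (E × E)) (Δ : Set (E × E)) (ℓ : ℕ) (ε : ℝ) : Prop where
  measurableSet : MeasurableSet Δ
  one_le : 1 ≤ ℓ
  eps_pos : 0 < ε
  weak_contraction : ∀ x y : E, ∫ z, dist z.1 z.2 ∂(Q (x, y)) ≤ dist x y
  contraction : ∀ x y : E, (x, y) ∈ Δ →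
    ∫ z, dist z.1 z.2 ∂((Q ^ ℓ) (x, y)) ≤ (1 - ε) * dist x y

/-- Concave increasing functions `φ : [0, ∞) → [0, ∞)` with `φ(t) → ∞` as `t → ∞`
(the values of `φ` on negative reals are irrelevant). -/
structure IsConcaveRate (φ : ℝ → ℝ) : Prop where
  nonneg : ∀ t, 0 ≤ t → 0 ≤ φ t
  concaveOn : ConcaveOn ℝ (Set.Ici 0) φ
  monotoneOn : MonotoneOn φ (Set.Ici 0)
  tendsto_atTop : Tendsto φ atTop atTop

/-- The double drift condition with constant `b`. The integrals `PV(x)` and `PV(y)` are taken in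
`[0, ∞]`, so their finiteness is part of the inequality. As `V ≥ 1`, the left-hand side is at
least `2`, so the truncation of the right-hand side at `0` by `ENNReal.ofReal` has no effect. -/
structure DoubleDrift {E : Type*} [MeasurableSpace E] (P : Kernel E E)
    (Δ : Set (E × E)) (φ : ℝ → ℝ) (V : E → ℝ) (b : ℝ) : Prop where
  measurableSet : MeasurableSet Δ
  rate : IsConcaveRate φ
  measurable : Measurable V
  one_le : ∀ x, 1 ≤ V x
  drift : ∀ x y : E,
    ∫⁻ z, ENNReal.ofReal (V z) ∂(P x) + ∫⁻ z, ENNReal.ofReal (V z) ∂(P y) ≤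
      ENNReal.ofReal (V x + V y - φ (V x + V y) + b * Δ.indicator (fun _ => (1 : ℝ)) (x, y))
  bddAbove : BddAbove ((fun z : E × E => V z.1 + V z.2) '' Δ)

open scoped ENNReal NNReal Topology

/-! ### Iterated kernels, drift inequalities and invariant measures. -/

section Powers

variable {α : Type*} [MeasurableSpace α]

lemma isMarkovKernel_pow (κ : Kernel α α) [IsMarkovKernel κ] (n : ℕ) : IsMarkovKernel (κ ^ n) := by
  induction n with
  | zero => rw [pow_zero]; exact inferInstanceAs (IsMarkovKernel Kernel.id)
  | succ n ih => rw [Kernel.pow_add]; rw [pow_one]; infer_instance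

lemma lintegral_pow_zero (κ : Kernel α α) {f : α → ℝ≥0∞} (hf : Measurable f) (x : α) :
    ∫⁻ y, f y ∂(κ ^ 0) x = f x := by
  rw [pow_zero, show (1 : Kernel α α) = Kernel.id from rfl, Kernel.id_apply, lintegral_dirac' x hf]

lemma lintegral_pow_add (κ : Kernel α α) (m n : ℕ) {f : α → ℝ≥0∞} (hf : Measurable f) (x : α) :
    ∫⁻ y, f y ∂(κ ^ (m + n)) x = ∫⁻ z, ∫⁻ y, f y ∂(κ ^ m) z ∂(κ ^ n) x := by
  rw [Kernel.pow_add, Kernel.lintegral_comp _ _ _ hf]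

lemma lintegral_pow_succ (κ : Kernel α α) (n : ℕ) {f : α → ℝ≥0∞} (hf : Measurable f) (x : α) :
    ∫⁻ y, f y ∂(κ ^ (n + 1)) x = ∫⁻ z, ∫⁻ y, f y ∂(κ ^ n) z ∂κ x := by
  rw [lintegral_pow_add κ n 1 hf, pow_one]

lemma lintegral_le_of_le_const {μ : Measure α} [IsProbabilityMeasure μ] {f : α → ℝ≥0∞} {c : ℝ≥0∞}
    (h : ∀ x, f x ≤ c) : ∫⁻ x, f x ∂μ ≤ c := by
  simpa using lintegral_mono (μ := μ) h

lemma lintegral_pow_le_add_of_drift (κ : Kernel α α) [IsMarkovKernel κ] {W : α → ℝ≥0∞}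
    (hW : Measurable W) {β : ℝ≥0∞} (h : ∀ x, ∫⁻ y, W y ∂κ x ≤ W x + β) (n : ℕ) (x : α) :
    ∫⁻ y, W y ∂(κ ^ n) x ≤ W x + n * β := by
  induction n generalizing x with
  | zero => rw [lintegral_pow_zero κ hW]; simp
  | succ n ih =>
    rw [lintegral_pow_succ κ n hW]
    calc _ ≤ ∫⁻ z, (W z + n * β) ∂κ x := lintegral_mono ih
      _ = ∫⁻ z, W z ∂κ x + n * β := by rw [lintegral_add_right _ measurable_const]; simp
      _ ≤ W x + β + n * β := by gcongr; exact h x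
      _ = _ := by push_cast; ring

lemma sum_lintegral_pow_le_of_drift (κ : Kernel α α) [IsMarkovKernel κ] {W ψ : α → ℝ≥0∞}
    (hψ : Measurable ψ) {β : ℝ≥0∞}
    (h : ∀ x, ∫⁻ y, W y ∂κ x + ψ x ≤ W x + β) (n : ℕ) (x : α) :
    ∑ k ∈ Finset.range n, ∫⁻ y, ψ y ∂(κ ^ k) x ≤ W x + n * β := by
  induction n generalizing x with
  | zero => simp
  | succ n ih =>
    rw [Finset.sum_range_succ', lintegral_pow_zero κ hψ]
    simp_rw [lintegral_pow_succ κ _ hψ]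
    rw [← lintegral_finsetSum _ (fun k _ => hψ.lintegral_kernel)]
    calc _ ≤ ∫⁻ z, (W z + n * β) ∂κ x + ψ x := by gcongr with z; exact ih z
      _ = ∫⁻ z, W z ∂κ x + ψ x + n * β := by
        rw [lintegral_add_right _ measurable_const]; simp; ring
      _ ≤ W x + β + n * β := add_le_add_left (h x) _
      _ = _ := by push_cast; ring

lemma ProbabilityTheory.Kernel.Invariant.lintegral_eq {κ : Kernel α α} {π : Measure α}
    (h : κ.Invariant π) {f : α → ℝ≥0∞} (hf : Measurable f) : ∫⁻ x, ∫⁻ y, f y ∂κ x ∂π = ∫⁻ x, f x ∂π := by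
  conv_rhs => rw [← h.def]
  rw [Measure.lintegral_bind κ.aemeasurable hf.aemeasurable]

lemma ProbabilityTheory.Kernel.Invariant.lintegral_pow_eq {κ : Kernel α α} {π : Measure α}
    (h : κ.Invariant π) {f : α → ℝ≥0∞} (hf : Measurable f) (n : ℕ) :
    ∫⁻ x, ∫⁻ y, f y ∂(κ ^ n) x ∂π = ∫⁻ x, f x ∂π := by
  induction n with
  | zero => simp_rw [lintegral_pow_zero κ hf]
  | succ n ih =>
    simp_rw [lintegral_pow_succ κ n hf]
    rw [Kernel.Invariant.lintegral_eq h hf.lintegral_kernel, ih]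

/-- An invariant probability measure integrates the rate `ψ` of a drift condition, even if the
Lyapunov function `W` is not known to be integrable. -/
lemma ProbabilityTheory.Kernel.Invariant.lintegral_le_of_drift {κ : Kernel α α}
    [IsMarkovKernel κ] {π : Measure α} [IsProbabilityMeasure π] (hπ : κ.Invariant π) {W ψ : α → ℝ≥0∞}
    (hW : Measurable W) (hψ : Measurable ψ) (hWtop : ∀ x, W x ≠ ∞) {β : ℝ≥0∞} (hβ : β ≠ ∞)
    (h : ∀ x, ∫⁻ y, W y ∂κ x + ψ x ≤ W x + β) : ∫⁻ x, ψ x ∂π ≤ β := by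
  have hmeas : ∀ M : ℕ, MeasurableSet {x | W x + β ≤ M} := fun M =>
    measurableSet_le (hW.add_const β) measurable_const
  have trunc : ∀ M : ℕ, ∫⁻ x, {x | W x + β ≤ M}.indicator ψ x ∂π ≤ β := by
    intro M
    -- Truncating `W` at `M` makes the integrals finite, so invariance can cancel them. The drift
    -- survives: below the threshold `min (W x) M` is `W x`, and above it the left side is at most
    -- `M < W x + β`.
    have pt : ∀ x, min (∫⁻ y, W y ∂κ x) M + {x | W x + β ≤ M}.indicator ψ x ≤ min (W x) M + β := by
      intro x
      by_cases hx : W x + β ≤ M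
      · rw [Set.indicator_of_mem (by exact hx)]
        have : W x ≤ M := le_self_add.trans hx
        rw [min_eq_left this]
        exact (add_le_add_left (min_le_left _ _) _).trans (h x)
      · rw [Set.indicator_of_notMem (by exact hx), add_zero]
        refine (min_le_right _ _).trans ?_
        rw [← min_add_add_right]
        exact le_min (not_le.1 hx).le le_self_add
    have hfin : ∫⁻ x, min (∫⁻ y, W y ∂κ x) M ∂π ≠ ∞ :=
      ((lintegral_le_of_le_const (c := (M : ℝ≥0∞)) fun x => min_le_right _ _).trans_lt
        (ENNReal.natCast_lt_top M)).ne
    have inv : ∫⁻ x, min (W x) M ∂π ≤ ∫⁻ x, min (∫⁻ y, W y ∂κ x) M ∂π := by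
      rw [← Kernel.Invariant.lintegral_eq hπ (hW.min measurable_const)]
      refine lintegral_mono fun x => le_min (lintegral_mono fun y => min_le_left _ _) ?_
      exact lintegral_le_of_le_const fun y => min_le_right _ _
    refine (ENNReal.add_le_add_iff_left hfin).1 ?_
    rw [← lintegral_add_left (hW.lintegral_kernel.min measurable_const)]
    calc _ ≤ ∫⁻ x, (min (W x) M + β) ∂π := lintegral_mono pt
      _ = ∫⁻ x, min (W x) M ∂π + β := by rw [lintegral_add_right _ measurable_const]; simp
      _ ≤ _ := by gcongr
  have hsup : ∀ x, ψ x = ⨆ M : ℕ, {x | W x + β ≤ M}.indicator ψ x := by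
    intro x
    refine le_antisymm ?_ (iSup_le fun M => Set.indicator_le_self' (fun _ _ => zero_le) x)
    obtain ⟨M, hM⟩ := ENNReal.exists_nat_gt (ENNReal.add_ne_top.2 ⟨hWtop x, hβ⟩)
    refine le_iSup_of_le M ?_
    rw [Set.indicator_of_mem (by exact hM.le)]
  simp_rw [hsup]
  rw [lintegral_iSup (fun M => hψ.indicator (hmeas M))]
  · exact iSup_le trunc
  · intro M N hMN x
    refine Set.indicator_le_indicator_of_subset (fun y hy => ?_) (fun _ => zero_le) x
    exact (Set.mem_ofPred.1 hy).trans (by exact_mod_cast hMN)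

end Powers

/-! ### Contraction of the mean distance under drift towards `Δ`. -/

section Contraction

variable {α : Type*} [MeasurableSpace α] {κ : Kernel α α}

lemma lintegral_pow_antitone {d : α → ℝ≥0∞} (hd : Measurable d)
    (h : ∀ z, ∫⁻ w, d w ∂κ z ≤ d z) (z : α) : Antitone fun n => ∫⁻ w, d w ∂(κ ^ n) z := by
  refine antitone_nat_of_succ_le fun n => ?_
  rw [add_comm, lintegral_pow_add κ 1 n hd, pow_one]
  exact lintegral_mono h

/-- Induction on the first step. Started in `Δ`, the factor `r` is gained within `ℓ` steps and kept
by monotonicity. Started outside, the drop of `U` by `c` pays for the extra term `c * d ≤ c`. No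
stopping time is needed. -/
lemma mul_lintegral_pow_le [IsMarkovKernel κ] {d U : α → ℝ≥0∞} (hd : Measurable d)
    (hU : Measurable U) (hd1 : ∀ z, d z ≤ 1) (hweak : ∀ z, ∫⁻ w, d w ∂κ z ≤ d z)
    {Δ : Set α} {ℓ : ℕ} {r c : ℝ≥0∞}
    (hcontr : ∀ z ∈ Δ, ∫⁻ w, d w ∂(κ ^ ℓ) z ≤ r * d z)
    (hdrift : ∀ z ∉ Δ, ∫⁻ w, U w ∂κ z + c ≤ U z) (k : ℕ) (z : α) :
    c * k * ∫⁻ w, d w ∂(κ ^ (ℓ + k)) z ≤ c * k * (r * d z) + U z := by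
  induction k generalizing z with
  | zero => simp
  | succ k ih =>
    by_cases hz : z ∈ Δ
    · refine le_trans ?_ le_self_add
      gcongr
      exact (lintegral_pow_antitone hd hweak z (Nat.le_add_right _ _)).trans (hcontr z hz)
    · have := isMarkovKernel_pow κ (ℓ + (k + 1))
      have h1 : ∫⁻ w, d w ∂(κ ^ (ℓ + (k + 1))) z ≤ 1 := lintegral_le_of_le_const hd1
      calc c * ↑(k + 1) * ∫⁻ w, d w ∂(κ ^ (ℓ + (k + 1))) z
          = c * k * ∫⁻ w, d w ∂(κ ^ (ℓ + (k + 1))) z + c * ∫⁻ w, d w ∂(κ ^ (ℓ + (k + 1))) z := by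
            push_cast; ring
        _ ≤ c * k * ∫⁻ w, d w ∂(κ ^ (ℓ + (k + 1))) z + c * 1 := by gcongr
        _ = ∫⁻ y, c * k * ∫⁻ w, d w ∂(κ ^ (ℓ + k)) y ∂κ z + c := by
            rw [← add_assoc, lintegral_pow_succ κ _ hd, lintegral_const_mul _ hd.lintegral_kernel,
              mul_one]
        _ ≤ ∫⁻ y, (c * k * (r * d y) + U y) ∂κ z + c := by gcongr with y; exact ih y
        _ = c * k * (r * ∫⁻ y, d y ∂κ z) + (∫⁻ y, U y ∂κ z + c) := by
            rw [lintegral_add_right _ hU, lintegral_const_mul _ (hd.const_mul r),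
              lintegral_const_mul _ hd, add_assoc]
        _ ≤ c * ↑(k + 1) * (r * d z) + U z := by
            gcongr
            · simp
            · exact hweak z
            · exact hdrift z hz

/-- Dividing `mul_lintegral_pow_le` by `c * k` gains a factor `r` up to an error `U / (c * k)`.
Iterating is possible because the mean of `U` after `n` steps is at most `R + n * β`, a bound that
does not depend on the starting point. -/
lemma exists_lintegral_pow_le [IsMarkovKernel κ] {d U : α → ℝ≥0∞} (hd : Measurable d)
    (hU : Measurable U) (hd1 : ∀ z, d z ≤ 1) (hweak : ∀ z, ∫⁻ w, d w ∂κ z ≤ d z)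
    {Δ : Set α} {ℓ : ℕ} {r c β : ℝ≥0∞} (hr : r < 1) (hc : c ≠ 0) (hctop : c ≠ ∞) (hβ : β ≠ ∞)
    (hcontr : ∀ z ∈ Δ, ∫⁻ w, d w ∂(κ ^ ℓ) z ≤ r * d z)
    (hdrift : ∀ z ∉ Δ, ∫⁻ w, U w ∂κ z + c ≤ U z)
    (hgrowth : ∀ z, ∫⁻ w, U w ∂κ z ≤ U z + β) {R : ℝ≥0∞} (hR : R ≠ ∞) {a : ℝ≥0∞} (ha : a ≠ 0) :
    ∃ n : ℕ, ∀ z, U z ≤ R → ∫⁻ w, d w ∂(κ ^ n) z ≤ a := by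
  have step : ∀ (j : ℕ) (δ : ℝ≥0∞), δ ≠ 0 → δ ≠ ∞ →
      ∃ n : ℕ, ∀ z, U z ≤ R → ∫⁻ w, d w ∂(κ ^ n) z ≤ r ^ j + δ := by
    intro j
    induction j with
    | zero =>
      intro δ _ _
      refine ⟨0, fun z _ => ?_⟩
      rw [lintegral_pow_zero κ hd, pow_zero]
      exact (hd1 z).trans le_self_add
    | succ j ih =>
      intro δ hδ hδtop
      have hδ2 : δ / 2 ≠ 0 := by simp [hδ]
      have hδ2top : δ / 2 ≠ ∞ := ENNReal.div_ne_top hδtop (by simp)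
      obtain ⟨n, hn⟩ := ih (δ / 2) hδ2 hδ2top
      -- `n` is fixed before `k`, so `k` can be large enough for `(R + n * β) / (c * k)` to stay
      -- below `δ / 2`.
      obtain ⟨k, hk⟩ := ENNReal.exists_nat_mul_gt (a := c * (δ / 2)) (b := R + n * β)
        (mul_ne_zero hc hδ2) (by finiteness)
      have hk0 : k ≠ 0 := by rintro rfl; simp at hk
      refine ⟨ℓ + k + n, fun z hz => ?_⟩
      have hck0 : c * k ≠ 0 := mul_ne_zero hc (by exact_mod_cast hk0)
      have hcktop : c * k ≠ ∞ := by finiteness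
      refine (ENNReal.mul_le_mul_iff_right hck0 hcktop).1 ?_
      have := isMarkovKernel_pow κ n
      calc c * k * ∫⁻ w, d w ∂(κ ^ (ℓ + k + n)) z
          = ∫⁻ y, c * k * ∫⁻ w, d w ∂(κ ^ (ℓ + k)) y ∂(κ ^ n) z := by
            rw [lintegral_pow_add κ _ _ hd, lintegral_const_mul _ hd.lintegral_kernel]
        _ ≤ ∫⁻ y, (c * k * (r * d y) + U y) ∂(κ ^ n) z :=
            lintegral_mono fun y => mul_lintegral_pow_le hd hU hd1 hweak hcontr hdrift k y
        _ = c * k * (r * ∫⁻ y, d y ∂(κ ^ n) z) + ∫⁻ y, U y ∂(κ ^ n) z := by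
            rw [lintegral_add_right _ hU, lintegral_const_mul _ (hd.const_mul r),
              lintegral_const_mul _ hd]
        _ ≤ c * k * (r * (r ^ j + δ / 2)) + (R + n * β) := by
            gcongr
            · exact hn z hz
            · exact (lintegral_pow_le_add_of_drift κ hU hgrowth n z).trans (by gcongr)
        _ ≤ c * k * (r ^ (j + 1) + δ / 2) + c * k * (δ / 2) := by
            gcongr
            · rw [mul_add, pow_succ']
              gcongr
              exact mul_le_of_le_one_left zero_le hr.le
            · exact hk.le.trans_eq (by ring)
        _ = c * k * (r ^ (j + 1) + δ) := by
            rw [← mul_add, add_assoc, ENNReal.add_halves]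
  -- `a` may be `∞`; `b` is a finite positive replacement.
  obtain ⟨b, hb0, hba⟩ := exists_between (pos_iff_ne_zero.2 ha)
  have hbtop : b ≠ ∞ := hba.ne_top
  have hb2 : b / 2 ≠ 0 := by simp [hb0.ne']
  obtain ⟨j, hj⟩ := ((ENNReal.tendsto_pow_atTop_nhds_zero_of_lt_one hr).eventually_le_const
    (pos_iff_ne_zero.2 hb2)).exists
  obtain ⟨n, hn⟩ := step j (b / 2) hb2 (ENNReal.div_ne_top hbtop (by simp))
  refine ⟨n, fun z hz => (hn z hz).trans ?_⟩
  calc r ^ j + b / 2 ≤ b / 2 + b / 2 := by gcongr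
    _ = b := ENNReal.add_halves b
    _ ≤ a := hba.le

end Contraction

/-! ### Marginals of the iterated coupling and the Lipschitz bound. -/

section Coupling

variable {E : Type*} [MeasurableSpace E] {P : Kernel E E} {Q : Kernel (E × E) (E × E)}

lemma IsCouplingKernel.lintegral_pow_fst (hQ : IsCouplingKernel P Q) {f : E → ℝ≥0∞}
    (hf : Measurable f) (n : ℕ) (z : E × E) :
    ∫⁻ w, f w.1 ∂(Q ^ n) z = ∫⁻ u, f u ∂(P ^ n) z.1 := by
  induction n generalizing z with
  | zero => rw [lintegral_pow_zero P hf, lintegral_pow_zero Q (f := fun w => f w.1) (hf.comp measurable_fst)]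
  | succ n ih =>
    rw [lintegral_pow_succ P n hf, lintegral_pow_succ Q n (f := fun w => f w.1)
      (hf.comp measurable_fst)]
    simp_rw [ih]
    rw [← hQ.map_fst z.1 z.2, lintegral_map hf.lintegral_kernel measurable_fst]

lemma IsCouplingKernel.lintegral_pow_snd (hQ : IsCouplingKernel P Q) {f : E → ℝ≥0∞}
    (hf : Measurable f) (n : ℕ) (z : E × E) :
    ∫⁻ w, f w.2 ∂(Q ^ n) z = ∫⁻ u, f u ∂(P ^ n) z.2 := by
  induction n generalizing z with
  | zero => rw [lintegral_pow_zero P hf, lintegral_pow_zero Q (f := fun w => f w.2) (hf.comp measurable_snd)]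
  | succ n ih =>
    rw [lintegral_pow_succ P n hf, lintegral_pow_succ Q n (f := fun w => f w.2)
      (hf.comp measurable_snd)]
    simp_rw [ih]
    rw [← hQ.map_snd z.1 z.2, lintegral_map hf.lintegral_kernel measurable_snd]

lemma IsCouplingKernel.lintegral_pow_le_add [PseudoEMetricSpace E] [SecondCountableTopology E]
    [OpensMeasurableSpace E] (hQ : IsCouplingKernel P Q) {f : E → ℝ≥0∞}
    (hf : Measurable f) {L : ℝ≥0∞} (hL : ∀ x y, f x ≤ f y + L * edist x y) (n : ℕ) (x y : E) :
    ∫⁻ u, f u ∂(P ^ n) x ≤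
      ∫⁻ u, f u ∂(P ^ n) y + L * ∫⁻ w, edist w.1 w.2 ∂(Q ^ n) (x, y) := by
  rw [← hQ.lintegral_pow_fst hf n (x, y), ← hQ.lintegral_pow_snd hf n (x, y),
    ← lintegral_const_mul _ measurable_edist,
    ← lintegral_add_left (f := fun w : E × E => f w.2) (hf.comp measurable_snd)]
  exact lintegral_mono fun w => hL w.1 w.2

end Coupling

/-! ### Bounded Lipschitz functions as test functions. -/

section LipschitzTests

variable {E : Type*} [PseudoMetricSpace E]

lemma coe_le_add_of_lipschitzWith {f : E → ℝ≥0} {L : ℝ≥0} (hf : LipschitzWith L f) (x y : E) :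
    (f x : ℝ≥0∞) ≤ f y + L * edist x y := by
  have h := hf.dist_le_mul x y
  rw [edist_nndist]
  norm_cast
  rw [← NNReal.coe_le_coe]
  push_cast
  rw [NNReal.dist_eq] at h
  linarith [le_abs_self ((f x : ℝ) - f y)]

lemma lipschitzWith_toNNReal_of_le_add {g : E → ℝ≥0∞} (hg : ∀ x, g x ≠ ∞) {L : ℝ≥0}
    (h : ∀ x y, g x ≤ g y + L * edist x y) : LipschitzWith L fun x => (g x).toNNReal := by
  have h' : ∀ x y, (g x).toReal ≤ (g y).toReal + L * dist x y := by
    intro x y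
    have := ENNReal.toReal_mono (by finiteness [hg y, edist_ne_top x y]) (h x y)
    rwa [ENNReal.toReal_add (hg y) (by finiteness), ENNReal.toReal_mul, ← dist_edist,
      ENNReal.coe_toReal] at this
  refine LipschitzWith.of_dist_le_mul fun x y => ?_
  rw [NNReal.dist_eq, abs_le]
  have h1 := h' x y
  have h2 := h' y x
  rw [dist_comm] at h2
  simp only [ENNReal.coe_toNNReal_eq_toReal]
  constructor <;> linarith

variable [MeasurableSpace E] [BorelSpace E]

/-- Thickened indicators of a closed set are Lipschitz, bounded by `1`, and decrease to its
indicator; closed sets form a generating π-system. -/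
lemma ext_of_forall_lipschitzWith_lintegral_eq {μ ν : Measure E} [IsFiniteMeasure μ]
    [IsFiniteMeasure ν] (h : ∀ (f : E → ℝ≥0) (L : ℝ≥0), LipschitzWith L f → (∀ x, f x ≤ 1) →
      ∫⁻ x, f x ∂μ = ∫⁻ x, f x ∂ν) : μ = ν := by
  have key : ∀ F : Set E, IsClosed F → μ F = ν F := by
    intro F hF
    have hpos : ∀ n : ℕ, (0 : ℝ) < 1 / (n + 1) := fun n => Nat.one_div_pos_of_nat
    have hlim := tendsto_one_div_add_atTop_nhds_zero_nat (𝕜 := ℝ)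
    have hμ := tendsto_lintegral_thickenedIndicator_of_isClosed μ hF hpos hlim
    have hν := tendsto_lintegral_thickenedIndicator_of_isClosed ν hF hpos hlim
    refine tendsto_nhds_unique hμ (hν.congr fun n => (h _ _
      (lipschitzWith_thickenedIndicator (hpos n) F) (thickenedIndicator_le_one (hpos n) F)).symm)
  apply ext_of_generate_finite _ ?_ isPiSystem_isClosed
  · exact fun F hF => key F hF
  · exact key _ isClosed_univ
  · rw [BorelSpace.measurable_eq (α := E), borel_eq_generateFrom_isClosed]

lemma tendsto_lintegral_of_lipschitzWith {ι : Type*} {l : Filter ι} {μs : ι → ProbabilityMeasure E}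
    {μ : ProbabilityMeasure E} (h : Tendsto μs l (𝓝 μ)) {f : E → ℝ≥0} {L : ℝ≥0}
    (hf : LipschitzWith L f) (hf1 : ∀ x, f x ≤ 1) :
    Tendsto (fun i => ∫⁻ x, f x ∂(μs i : Measure E)) l (𝓝 (∫⁻ x, f x ∂(μ : Measure E))) := by
  refine ProbabilityMeasure.tendsto_iff_forall_lintegral_tendsto.1 h
    (BoundedContinuousFunction.mkOfBound ⟨f, hf.continuous⟩ 1 fun x y => ?_)
  have hx : (f x : ℝ) ≤ 1 := hf1 x
  have hy : (f y : ℝ) ≤ 1 := hf1 y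
  simp only [ContinuousMap.coe_mk, NNReal.dist_eq, abs_le]
  constructor <;> linarith [(f x).coe_nonneg, (f y).coe_nonneg]

end LipschitzTests

/-! ### Tightness criteria in a complete metric space. -/

section Tightness

/-- Markov's inequality; with `δ ≤ 1` the truncation at `1` does no harm. -/
lemma measure_compl_cthickening_le {E : Type*} [PseudoMetricSpace E] [MeasurableSpace E]
    [OpensMeasurableSpace E] {μ : Measure E} {K : Set E} {δ : ℝ} (hδ1 : δ ≤ 1) :
    ENNReal.ofReal δ * μ (Metric.cthickening δ K)ᶜ ≤
      ∫⁻ x, min (Metric.infEDist x K) 1 ∂μ := by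
  have hm : Measurable fun x => min (Metric.infEDist x K) 1 := by fun_prop
  refine le_trans ?_ (mul_meas_ge_le_lintegral hm (ENNReal.ofReal δ))
  gcongr
  intro x hx
  rw [Set.mem_ofPred]
  refine le_min ?_ (by simpa using hδ1)
  rw [Set.mem_compl_iff, Metric.mem_cthickening_iff, not_le] at hx
  exact hx.le

variable {E : Type*} [MetricSpace E] [CompleteSpace E] [MeasurableSpace E]

/-- Intersecting closed thickenings of compact sets with radii tending to `0` gives a closed,
totally bounded set, hence a compact one; the lost masses are summable. -/
lemma isTightMeasureSet_of_forall_cthickening {S : Set (Measure E)}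
    (h : ∀ δ : ℝ, 0 < δ → ∀ η : ℝ≥0∞, η ≠ 0 →
      ∃ K : Set E, IsCompact K ∧ ∀ μ ∈ S, μ (Metric.cthickening δ K)ᶜ ≤ η) :
    IsTightMeasureSet S := by
  rw [isTightMeasureSet_iff_exists_isCompact_measure_compl_le]
  intro η hη
  obtain ⟨u, hu0, hu⟩ := ENNReal.exists_pos_sum_of_countable' hη.ne' ℕ
  choose K hK hKS using fun n : ℕ =>
    h (1 / (n + 1)) Nat.one_div_pos_of_nat (u n) (hu0 n).ne'
  refine ⟨⋂ n : ℕ, Metric.cthickening (1 / (n + 1)) (K n), ?_, fun μ hμ => ?_⟩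
  · refine TotallyBounded.isCompact_of_isClosed ?_
      (isClosed_iInter fun n => Metric.isClosed_cthickening)
    refine Metric.totallyBounded_iff.2 fun δ hδ => ?_
    obtain ⟨n, hn⟩ := exists_nat_one_div_lt (half_pos hδ)
    obtain ⟨t, ht, htK⟩ := Metric.totallyBounded_iff.1 (hK n).totallyBounded (δ / 2) (half_pos hδ)
    refine ⟨t, ht, fun x hx => ?_⟩
    have hx' := Metric.cthickening_subset_thickening' (half_pos hδ) hn (K n) (Set.mem_iInter.1 hx n)
    obtain ⟨y, hy, hxy⟩ := Metric.mem_thickening_iff.1 hx'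
    obtain ⟨z, hz, hyz⟩ := Set.mem_iUnion₂.1 (htK hy)
    refine Set.mem_iUnion₂.2 ⟨z, hz, ?_⟩
    rw [Metric.mem_ball] at hyz ⊢
    linarith [dist_triangle x y z]
  · rw [Set.compl_iInter]
    calc _ ≤ ∑' n, μ (Metric.cthickening (1 / ((n : ℕ) + 1 : ℝ)) (K n))ᶜ := measure_iUnion_le _
      _ ≤ ∑' n, u n := ENNReal.tsum_le_tsum fun n => hKS n μ hμ
      _ ≤ η := hu.le

variable [SecondCountableTopology E] [BorelSpace E]

lemma exists_isCompact_forall_lt_measure_compl_le (μ : ℕ → Measure E) [∀ n, IsFiniteMeasure (μ n)]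
    (N : ℕ) {η : ℝ≥0∞} (hη : η ≠ 0) : ∃ K : Set E, IsCompact K ∧ ∀ n < N, μ n Kᶜ ≤ η := by
  have h : ∀ n, ∃ K : Set E, IsCompact K ∧ μ n Kᶜ ≤ η := fun n => by
    obtain ⟨K, hK, hKμ⟩ := isTightMeasureSet_iff_exists_isCompact_measure_compl_le.1
      (isTightMeasureSet_singleton (μ := μ n)) η (pos_iff_ne_zero.2 hη)
    exact ⟨K, hK, hKμ _ rfl⟩
  choose K hK hKμ using h
  refine ⟨⋃ n ∈ Finset.range N, K n, (Finset.range N).isCompact_biUnion fun n _ => hK n,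
    fun n hn => (measure_mono ?_).trans (hKμ n)⟩
  exact Set.compl_subset_compl.2 (Set.subset_biUnion_of_mem (u := K) (Finset.mem_range.2 hn))

/-- The finitely many initial measures are each tight, so one more compact set absorbs them. -/
lemma isTightMeasureSet_range_of_eventually (μ : ℕ → Measure E) [∀ n, IsFiniteMeasure (μ n)]
    (h : ∀ η : ℝ≥0∞, η ≠ 0 → ∃ K : Set E, IsCompact K ∧
      ∀ᶠ n in atTop, ∫⁻ x, min (Metric.infEDist x K) 1 ∂μ n ≤ η) :
    IsTightMeasureSet (Set.range μ) := by
  refine isTightMeasureSet_of_forall_cthickening fun δ hδ η hη => ?_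
  set δ' := min δ 1 with hδ'
  have hδ'pos : 0 < δ' := lt_min hδ one_pos
  have hδ'0 : ENNReal.ofReal δ' ≠ 0 := by simpa using hδ'pos
  obtain ⟨K, hK, hKμ⟩ := h (ENNReal.ofReal δ' * η) (mul_ne_zero hδ'0 hη)
  obtain ⟨N, hN⟩ := eventually_atTop.1 hKμ
  obtain ⟨K', hK', hK'μ⟩ := exists_isCompact_forall_lt_measure_compl_le μ N hη
  refine ⟨K ∪ K', hK.union hK', ?_⟩
  rintro _ ⟨n, rfl⟩
  rcases lt_or_ge n N with hn | hn
  · refine (measure_mono (Set.compl_subset_compl.2 ?_)).trans (hK'μ n hn)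
    exact Set.subset_union_right.trans (Metric.self_subset_cthickening _)
  · refine (measure_mono (Set.compl_subset_compl.2 ?_)).trans
      ((ENNReal.mul_le_mul_iff_right hδ'0 ENNReal.ofReal_ne_top).1
        ((measure_compl_cthickening_le (min_le_right _ _)).trans (hN n hn)))
    exact (Metric.cthickening_mono (min_le_left _ _) _).trans
      (Metric.cthickening_subset_of_subset _ Set.subset_union_left)

end Tightness

/-! ### Time averages of the chain. -/

section Cesaro

variable {E : Type*} [MeasurableSpace E]

lemma sum_range_le_add_sum_range_add {g : ℕ → ℝ≥0∞} (hg : ∀ k, g k ≤ 1) (m n : ℕ) :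
    ∑ k ∈ Finset.range m, g k ≤ n + ∑ k ∈ Finset.range m, g (n + k) := by
  calc ∑ k ∈ Finset.range m, g k ≤ ∑ k ∈ Finset.range (n + m), g k :=
        Finset.sum_le_sum_of_subset (Finset.range_subset_range.2 (Nat.le_add_left m n))
    _ = ∑ k ∈ Finset.range n, g k + ∑ k ∈ Finset.range m, g (n + k) := Finset.sum_range_add _ _ _
    _ ≤ ∑ k ∈ Finset.range n, 1 + ∑ k ∈ Finset.range m, g (n + k) := by
        gcongr with k; exact hg k
    _ = _ := by simp

/-- The law of the chain started from `x`, averaged over the times `0, …, m`. -/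
noncomputable def cesaroMeasure (P : Kernel E E) (x : E) (m : ℕ) : Measure E :=
  ((m + 1 : ℕ) : ℝ≥0∞)⁻¹ • ∑ k ∈ Finset.range (m + 1), (P ^ k) x

lemma lintegral_cesaroMeasure (P : Kernel E E) (x : E) (m : ℕ) (f : E → ℝ≥0∞) :
    ∫⁻ y, f y ∂cesaroMeasure P x m =
      ((m + 1 : ℕ) : ℝ≥0∞)⁻¹ * ∑ k ∈ Finset.range (m + 1), ∫⁻ y, f y ∂(P ^ k) x := by
  rw [cesaroMeasure, lintegral_smul_measure, lintegral_finsetSum_measure, smul_eq_mul]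

variable (P : Kernel E E) [IsMarkovKernel P]

instance isProbabilityMeasure_cesaroMeasure (x : E) (m : ℕ) :
    IsProbabilityMeasure (cesaroMeasure P x m) := by
  constructor
  have := fun k => isMarkovKernel_pow P k
  rw [← lintegral_one, lintegral_cesaroMeasure]
  simp only [lintegral_one, measure_univ, Finset.sum_const, Finset.card_range, nsmul_eq_mul,
    mul_one]
  exact ENNReal.inv_mul_cancel (by simp) (ENNReal.natCast_ne_top _)

/-- Shifting time by `n` loses at most `n` terms, each at most `1`. With `n = 1`, this and the next
lemma give approximate invariance in the two directions. -/
lemma lintegral_cesaroMeasure_le_add (x : E) (m n : ℕ) {f : E → ℝ≥0∞} (hf : Measurable f)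
    (hf1 : ∀ y, f y ≤ 1) :
    ∫⁻ y, f y ∂cesaroMeasure P x m ≤
      ((m + 1 : ℕ) : ℝ≥0∞)⁻¹ * n + ∫⁻ y, ∫⁻ z, f z ∂(P ^ n) y ∂cesaroMeasure P x m := by
  rw [lintegral_cesaroMeasure, lintegral_cesaroMeasure, ← mul_add]
  simp_rw [← lintegral_pow_add P n _ hf]
  gcongr
  have := fun k => isMarkovKernel_pow P k
  exact sum_range_le_add_sum_range_add (g := fun k => ∫⁻ y, f y ∂(P ^ k) x)
    (fun k => lintegral_le_of_le_const hf1) _ _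

lemma lintegral_lintegral_cesaroMeasure_le_add (x : E) (m : ℕ) {f : E → ℝ≥0∞} (hf : Measurable f)
    (hf1 : ∀ y, f y ≤ 1) :
    ∫⁻ y, ∫⁻ z, f z ∂P y ∂cesaroMeasure P x m ≤
      ∫⁻ y, f y ∂cesaroMeasure P x m + ((m + 1 : ℕ) : ℝ≥0∞)⁻¹ := by
  have hpow : ∀ k, ∫⁻ y, ∫⁻ z, f z ∂P y ∂(P ^ k) x = ∫⁻ z, f z ∂(P ^ (k + 1)) x := fun k => by
    rw [add_comm, lintegral_pow_add P 1 k hf, pow_one]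
  rw [lintegral_cesaroMeasure, lintegral_cesaroMeasure]
  simp_rw [hpow]
  have := isMarkovKernel_pow P (m + 1)
  calc _ ≤ ((m + 1 : ℕ) : ℝ≥0∞)⁻¹ *
        ∑ k ∈ Finset.range (m + 1 + 1), ∫⁻ z, f z ∂(P ^ k) x := by
        rw [Finset.sum_range_succ' _ (m + 1)]; gcongr; exact le_self_add
    _ ≤ ((m + 1 : ℕ) : ℝ≥0∞)⁻¹ * (∑ k ∈ Finset.range (m + 1), ∫⁻ z, f z ∂(P ^ k) x + 1) := by
        rw [Finset.sum_range_succ _ (m + 1)]; gcongr; exact lintegral_le_of_le_const hf1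
    _ = _ := by rw [mul_add, mul_one]

lemma lintegral_cesaroMeasure_le_of_drift {W ψ : E → ℝ≥0∞} (hψ : Measurable ψ) {β : ℝ≥0∞}
    (h : ∀ x, ∫⁻ y, W y ∂P x + ψ x ≤ W x + β) (x : E) (m : ℕ) :
    ∫⁻ y, ψ y ∂cesaroMeasure P x m ≤ W x + β := by
  rw [lintegral_cesaroMeasure]
  have h0 : ((m + 1 : ℕ) : ℝ≥0∞) ≠ 0 := by simp
  calc _ ≤ ((m + 1 : ℕ) : ℝ≥0∞)⁻¹ * (W x + (m + 1 : ℕ) * β) := by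
        gcongr; exact sum_lintegral_pow_le_of_drift P hψ h (m + 1) x
    _ = ((m + 1 : ℕ) : ℝ≥0∞)⁻¹ * W x + β := by
        rw [mul_add, ← mul_assoc, ENNReal.inv_mul_cancel h0 (ENNReal.natCast_ne_top _), one_mul]
    _ ≤ W x + β := by
        gcongr
        refine mul_le_of_le_one_left zero_le (ENNReal.inv_le_one.2 ?_)
        exact_mod_cast Nat.le_add_left 1 m

lemma tendsto_inv_natCast_succ_mul {c : ℝ≥0∞} (hc : c ≠ ∞) :
    Tendsto (fun m : ℕ => ((m + 1 : ℕ) : ℝ≥0∞)⁻¹ * c) atTop (𝓝 0) := by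
  have := ENNReal.Tendsto.mul_const
    ((tendsto_add_atTop_iff_nat 1).2 ENNReal.tendsto_inv_nat_nhds_zero) (Or.inr hc)
  simpa using this

end Cesaro

/-! ### Existence of an invariant probability measure. -/

section Existence

variable {E : Type*} [MetricSpace E] [MeasurableSpace E] [BorelSpace E] {P : Kernel E E}
  [IsMarkovKernel P]

/-- Krylov–Bogoliubov: a kernel that maps Lipschitz functions to Lipschitz functions and has tight
time averages has an invariant probability measure. -/
lemma exists_invariant_of_isTightMeasureSet {x : E}
    (hlip : ∀ f : E → ℝ≥0∞, Measurable f → ∀ L : ℝ≥0, (∀ y z, f y ≤ f z + L * edist y z) →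
      ∀ y z, ∫⁻ u, f u ∂P y ≤ ∫⁻ u, f u ∂P z + L * edist y z)
    (ht : IsTightMeasureSet (Set.range (cesaroMeasure P x))) :
    ∃ π : Measure E, IsProbabilityMeasure π ∧ P.Invariant π := by
  let μ : ℕ → ProbabilityMeasure E := fun m => ⟨cesaroMeasure P x m, inferInstance⟩
  have hcomp : IsCompact (closure (Set.range μ)) := by
    refine isCompact_closure_of_isTightMeasureSet (ht.subset ?_)
    rintro _ ⟨_, ⟨m, rfl⟩, rfl⟩
    exact ⟨m, rfl⟩
  obtain ⟨π, -, hπ⟩ := hcomp.exists_mapClusterPt (f := atTop) (u := μ)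
    (tendsto_principal.2 (Eventually.of_forall fun m => subset_closure ⟨m, rfl⟩))
  -- Along an ultrafilter the cluster point is an actual limit, so no subsequence has to be
  -- extracted.
  obtain ⟨𝒰, h𝒰, hlim⟩ := mapClusterPt_iff_ultrafilter.1 hπ
  refine ⟨π, inferInstance, ?_⟩
  have hinv : Tendsto (fun m : ℕ => ((m + 1 : ℕ) : ℝ≥0∞)⁻¹) 𝒰 (𝓝 0) := by
    simpa using (tendsto_inv_natCast_succ_mul ENNReal.one_ne_top).mono_left h𝒰
  refine ext_of_forall_lipschitzWith_lintegral_eq fun f L hf hf1 => ?_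
  have hfm : Measurable fun y => (f y : ℝ≥0∞) := hf.continuous.measurable.coe_nnreal_ennreal
  have hf1' : ∀ y, (f y : ℝ≥0∞) ≤ 1 := fun y => by exact_mod_cast hf1 y
  have hPf1 : ∀ y, ∫⁻ u, f u ∂P y ≤ 1 := fun y => lintegral_le_of_le_const hf1'
  have hPftop : ∀ y, ∫⁻ u, f u ∂P y ≠ ∞ := fun y => ((hPf1 y).trans_lt ENNReal.one_lt_top).ne
  -- `P f` is again a bounded Lipschitz test function, so its integrals converge too.
  have hPf := lipschitzWith_toNNReal_of_le_add hPftop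
    (hlip _ hfm L (coe_le_add_of_lipschitzWith hf))
  have lim1 := tendsto_lintegral_of_lipschitzWith hlim hf hf1
  have lim2 := tendsto_lintegral_of_lipschitzWith hlim hPf
    (fun y => by simpa using ENNReal.toNNReal_mono ENNReal.one_ne_top (hPf1 y))
  simp_rw [ENNReal.coe_toNNReal (hPftop _)] at lim2
  rw [Measure.lintegral_bind P.aemeasurable hfm.aemeasurable]
  apply le_antisymm
  · refine le_of_tendsto_of_tendsto lim2 ((add_zero (∫⁻ y, f y ∂(π : Measure E))) ▸ lim1.add hinv)
      (Eventually.of_forall fun m => ?_)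
    exact lintegral_lintegral_cesaroMeasure_le_add P x m hfm hf1'
  · refine le_of_tendsto_of_tendsto lim1
      ((zero_add (∫⁻ y, ∫⁻ u, f u ∂P y ∂(π : Measure E))) ▸ hinv.add lim2)
      (Eventually.of_forall fun m => ?_)
    have := lintegral_cesaroMeasure_le_add P x m 1 hfm hf1'
    rwa [Nat.cast_one, mul_one, pow_one] at this

/-- Choose a compact `K` carrying most of `P^n(x, ·)`. By coupling, the chain from `y` is after `n`
steps about as close to `K` as the chain from `x`, up to `a + a * ψ y`, and the averages of `ψ` are
bounded by `C`. -/
lemma isTightMeasureSet_range_cesaroMeasure [CompleteSpace E] [SecondCountableTopology E]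
    {Q : Kernel (E × E) (E × E)} (hQ : IsCouplingKernel P Q) {x : E} {ψ : E → ℝ≥0∞}
    (hψ : Measurable ψ) {C : ℝ≥0∞} (hC : C ≠ ∞) (hψC : ∀ m, ∫⁻ y, ψ y ∂cesaroMeasure P x m ≤ C)
    (hcontr : ∀ a : ℝ≥0∞, a ≠ 0 →
      ∃ n : ℕ, ∀ y, ∫⁻ w, edist w.1 w.2 ∂(Q ^ n) (y, x) ≤ a + a * ψ y) :
    IsTightMeasureSet (Set.range (cesaroMeasure P x)) := by
  refine isTightMeasureSet_range_of_eventually _ fun η hη => ?_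
  -- Three errors of size `a` (time shift, mass of `P^n(x, ·)` off `K`, constant part of the
  -- coupling bound), plus `a * C` from `ψ`.
  set a := η / (3 + C) with ha
  have ha0 : a ≠ 0 := ENNReal.div_ne_zero.2 ⟨hη, by finiteness⟩
  obtain ⟨n, hn⟩ := hcontr a ha0
  have := isMarkovKernel_pow P n
  obtain ⟨K, hK, hKx⟩ := isTightMeasureSet_iff_exists_isCompact_measure_compl_le.1
    (isTightMeasureSet_singleton (μ := (P ^ n) x)) a (pos_iff_ne_zero.2 ha0)
  refine ⟨K, hK, ?_⟩
  set f : E → ℝ≥0∞ := fun y => min (Metric.infEDist y K) 1 with hf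
  have hfm : Measurable f := by fun_prop
  have hf1 : ∀ y, f y ≤ 1 := fun y => min_le_right _ _
  have hflip : ∀ y z, f y ≤ f z + 1 * edist y z := by
    intro y z
    rw [one_mul, hf, ← min_add_add_right]
    exact le_min ((min_le_left _ _).trans Metric.infEDist_le_infEDist_add_edist)
      ((min_le_right _ _).trans le_self_add)
  have hfx : ∫⁻ y, f y ∂(P ^ n) x ≤ a := by
    refine le_trans ?_ (hKx _ rfl)
    rw [← lintegral_indicator_one hK.isClosed.measurableSet.compl]
    refine lintegral_mono fun y => ?_
    by_cases hy : y ∈ K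
    · simp [hf, Metric.infEDist_zero_of_mem hy]
    · simpa [hy] using hf1 y
  have hpt : ∀ y, ∫⁻ z, f z ∂(P ^ n) y ≤ 2 * a + a * ψ y := by
    intro y
    refine (hQ.lintegral_pow_le_add hfm hflip n y x).trans ?_
    rw [one_mul, two_mul, add_assoc]
    exact add_le_add hfx (hn y)
  filter_upwards [(tendsto_inv_natCast_succ_mul (ENNReal.natCast_ne_top n)).eventually_le_const
    (pos_iff_ne_zero.2 ha0)] with m hm
  calc ∫⁻ y, f y ∂cesaroMeasure P x m
      ≤ a + ∫⁻ y, (2 * a + a * ψ y) ∂cesaroMeasure P x m :=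
        (lintegral_cesaroMeasure_le_add P x m n hfm hf1).trans
          (add_le_add hm (lintegral_mono hpt))
    _ = a + (2 * a + a * ∫⁻ y, ψ y ∂cesaroMeasure P x m) := by
        rw [lintegral_add_left measurable_const, lintegral_const_mul _ hψ]; simp
    _ ≤ a + (2 * a + a * C) := by gcongr; exact hψC m
    _ = (3 + C) * a := by ring
    _ ≤ η := ENNReal.mul_div_le

end Existence

/-! ### Uniqueness of the invariant probability measure. -/

section Uniqueness

variable {E : Type*} [MetricSpace E] [SecondCountableTopology E] [MeasurableSpace E] [BorelSpace E]
  {P : Kernel E E} {Q : Kernel (E × E) (E × E)}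

/-- Start the coupled chain from `π.prod π'`: its marginals stay `π` and `π'`, while the mean
distance tends to `0` by dominated convergence, so pointwise convergence suffices. -/
lemma invariant_unique (hQ : IsCouplingKernel P Q) (hd : ∀ x y : E, edist x y ≤ 1)
    (hlim : ∀ z : E × E, Tendsto (fun n => ∫⁻ w, edist w.1 w.2 ∂(Q ^ n) z) atTop (𝓝 0))
    {π π' : Measure E} [IsProbabilityMeasure π] [IsProbabilityMeasure π']
    (hπ : P.Invariant π) (hπ' : P.Invariant π') : π = π' := by
  have := hQ.isMarkovKernel
  have hQn := fun n => isMarkovKernel_pow Q n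
  have hdm : Measurable fun w : E × E => edist w.1 w.2 := measurable_edist
  have key : ∀ (π π' : Measure E) [IsProbabilityMeasure π] [IsProbabilityMeasure π'],
      P.Invariant π → P.Invariant π' → ∀ (f : E → ℝ≥0) (L : ℝ≥0), LipschitzWith L f →
      ∫⁻ x, f x ∂π ≤ ∫⁻ x, f x ∂π' := by
    intro π π' _ _ hπ hπ' f L hf
    have hfm : Measurable fun y => (f y : ℝ≥0∞) := hf.continuous.measurable.coe_nnreal_ennreal
    have hzero : Tendsto (fun n => ∫⁻ z, ∫⁻ w, edist w.1 w.2 ∂(Q ^ n) z ∂π.prod π') atTop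
        (𝓝 0) := by
      have := tendsto_lintegral_of_dominated_convergence (μ := π.prod π') (fun _ => (1 : ℝ≥0∞))
        (fun n => hdm.lintegral_kernel (κ := Q ^ n))
        (fun n => Eventually.of_forall fun z => lintegral_le_of_le_const fun w => hd w.1 w.2)
        (by simp) (Eventually.of_forall hlim)
      simpa using this
    have hbound : ∀ n, ∫⁻ x, f x ∂π ≤
        ∫⁻ x, f x ∂π' + L * ∫⁻ z, ∫⁻ w, edist w.1 w.2 ∂(Q ^ n) z ∂π.prod π' := by
      intro n
      have hgm : Measurable fun y => ∫⁻ u, f u ∂(P ^ n) y := hfm.lintegral_kernel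
      have e1 : ∫⁻ x, f x ∂π = ∫⁻ z, ∫⁻ u, f u ∂(P ^ n) z.1 ∂π.prod π' := by
        rw [← Kernel.Invariant.lintegral_pow_eq hπ hfm n,
          ← (measurePreserving_fst (μ := π) (ν := π')).lintegral_comp hgm]
      have e2 : ∫⁻ x, f x ∂π' = ∫⁻ z, ∫⁻ u, f u ∂(P ^ n) z.2 ∂π.prod π' := by
        rw [← Kernel.Invariant.lintegral_pow_eq hπ' hfm n,
          ← (measurePreserving_snd (μ := π) (ν := π')).lintegral_comp hgm]
      rw [e1, e2, ← lintegral_const_mul _ hdm.lintegral_kernel,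
        ← lintegral_add_right _ (hdm.lintegral_kernel.const_mul _)]
      exact lintegral_mono fun z =>
        hQ.lintegral_pow_le_add hfm (coe_le_add_of_lipschitzWith hf) n z.1 z.2
    refine ge_of_tendsto' (x := atTop) ?_ hbound
    simpa using tendsto_const_nhds.add
      (ENNReal.Tendsto.const_mul hzero (Or.inr ENNReal.coe_ne_top))
  exact ext_of_forall_lipschitzWith_lintegral_eq fun f L hf _ =>
    le_antisymm (key π π' hπ hπ' f L hf) (key π' π hπ' hπ f L hf)

end Uniqueness

/-- By concavity `φ` lies above the chord from `0` to some `s > t` with `φ s > 0`. This makes the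
drop `φ 2` strictly positive. -/
lemma IsConcaveRate.pos {φ : ℝ → ℝ} (h : IsConcaveRate φ) {t : ℝ} (ht : 0 < t) : 0 < φ t := by
  by_contra! hle
  obtain ⟨s, hst, hs⟩ := ((eventually_gt_atTop t).and
    (h.tendsto_atTop.eventually_gt_atTop 0)).exists
  have hs0 : 0 < s := ht.trans hst
  have hc := h.concaveOn.2 (Set.mem_Ici.2 (le_refl 0)) (Set.mem_Ici.2 hs0.le)
    (sub_nonneg.2 ((div_le_one hs0).2 hst.le)) (show 0 ≤ t / s by positivity) (by ring)
  simp only [smul_eq_mul, mul_zero, zero_add, div_mul_cancel₀ _ hs0.ne'] at hc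
  have h0 : 0 ≤ (1 - t / s) * φ 0 :=
    mul_nonneg (sub_nonneg.2 ((div_le_one hs0).2 hst.le)) (h.nonneg 0 le_rfl)
  have h1 : 0 < t / s * φ s := by positivity
  linarith

/-! ### Consequences of the double drift condition. -/

section DoubleDrift

variable {E : Type*} [MeasurableSpace E] {P : Kernel E E} {Q : Kernel (E × E) (E × E)}
  {Δ : Set (E × E)} {φ : ℝ → ℝ} {V : E → ℝ} {b : ℝ}

/-- `φ` is arbitrary on negative reals, so measurability comes from the monotone function `t ↦ φ
(max t 0)`, which agrees with `φ` on the values of `V`. -/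
lemma DoubleDrift.measurable_rate (h : DoubleDrift P Δ φ V b) : Measurable fun x => φ (V x) := by
  have hm : Monotone fun t : ℝ => φ (max t 0) := fun s t hst =>
    h.rate.monotoneOn (Set.mem_Ici.2 (le_max_right _ _)) (Set.mem_Ici.2 (le_max_right _ _))
      (max_le_max_right 0 hst)
  have := hm.measurable.comp h.measurable
  convert this using 2 with x
  simp [max_eq_left (zero_le_one.trans (h.one_le x))]

lemma DoubleDrift.lintegral_add_le [IsMarkovKernel P] (h : DoubleDrift P Δ φ V b) (x y : E) :
    ∫⁻ z, ENNReal.ofReal (V z) ∂P x + ∫⁻ z, ENNReal.ofReal (V z) ∂P y +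
        ENNReal.ofReal (φ (V x + V y)) ≤
      ENNReal.ofReal (V x) + ENNReal.ofReal (V y) +
        Δ.indicator (fun _ => ENNReal.ofReal |b|) (x, y) := by
  have hx := h.one_le x
  have hy := h.one_le y
  have hφ : 0 ≤ φ (V x + V y) := h.rate.nonneg _ (by linarith)
  have hd := h.drift x y
  set I := ∫⁻ z, ENNReal.ofReal (V z) ∂P x + ∫⁻ z, ENNReal.ofReal (V z) ∂P y
  set D := Δ.indicator (fun _ => (1 : ℝ)) (x, y) with hD
  have hD0 : 0 ≤ D := Set.indicator_nonneg (fun _ _ => zero_le_one) _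
  have hDind : Δ.indicator (fun _ => ENNReal.ofReal |b|) (x, y) = ENNReal.ofReal (|b| * D) := by
    by_cases hz : (x, y) ∈ Δ <;> simp [hD, hz]
  rw [hDind, ← ENNReal.ofReal_add (by linarith) (by linarith),
    ← ENNReal.ofReal_add (by linarith) (by positivity)]
  have hbD : b * D ≤ |b| * D := mul_le_mul_of_nonneg_right (le_abs_self b) hD0
  rcases le_total 0 (V x + V y - φ (V x + V y) + b * D) with h0 | h0
  · calc I + ENNReal.ofReal (φ (V x + V y))
        ≤ ENNReal.ofReal (V x + V y - φ (V x + V y) + b * D) + ENNReal.ofReal (φ (V x + V y)) := by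
          gcongr
      _ = ENNReal.ofReal (V x + V y + b * D) := by
          rw [← ENNReal.ofReal_add h0 hφ]; congr 1; ring
      _ ≤ _ := ENNReal.ofReal_le_ofReal (by linarith)
  -- A nonpositive right side would force `PV = 0`, against `V ≥ 1`.
  · rw [ENNReal.ofReal_of_nonpos h0, nonpos_iff_eq_zero, add_eq_zero] at hd
    have h1 : 1 ≤ ∫⁻ z, ENNReal.ofReal (V z) ∂P x := by
      simpa using lintegral_mono (μ := P x) (f := fun _ => (1 : ℝ≥0∞)) fun z =>
        ENNReal.one_le_ofReal.2 (h.one_le z)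
    rw [hd.1] at h1
    exact absurd h1 (by simp)

/-- The integral of `V(x) + V(y)` sees only the marginals of `Q`, and `V(x) + V(y) ≥ 2` bounds the
rate below by `φ 2`. -/
lemma DoubleDrift.lintegral_coupling_add_le [IsMarkovKernel P] (h : DoubleDrift P Δ φ V b)
    (hQ : IsCouplingKernel P Q) (z : E × E) :
    ∫⁻ w, (ENNReal.ofReal (V w.1) + ENNReal.ofReal (V w.2)) ∂Q z + ENNReal.ofReal (φ 2) ≤
      ENNReal.ofReal (V z.1) + ENNReal.ofReal (V z.2) +
        Δ.indicator (fun _ => ENNReal.ofReal |b|) z := by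
  have hV : Measurable fun x => ENNReal.ofReal (V x) := h.measurable.ennreal_ofReal
  have h1 := hQ.lintegral_pow_fst hV 1 z
  have h2 := hQ.lintegral_pow_snd hV 1 z
  rw [pow_one, pow_one] at h1 h2
  rw [lintegral_add_left (f := fun w : E × E => ENNReal.ofReal (V w.1)) (hV.comp measurable_fst),
    h1, h2]
  refine le_trans ?_ (h.lintegral_add_le z.1 z.2)
  gcongr
  have hx := h.one_le z.1
  have hy := h.one_le z.2
  exact h.rate.monotoneOn (Set.mem_Ici.2 zero_le_two) (Set.mem_Ici.2 (by linarith)) (by linarith)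

/-- The double drift on the diagonal is a single-chain drift for `2V`, with `φ (2V) ≥ φ V` by
monotonicity. -/
lemma DoubleDrift.lintegral_add_rate_le [IsMarkovKernel P] (h : DoubleDrift P Δ φ V b) (x : E) :
    ∫⁻ y, (ENNReal.ofReal (V y) + ENNReal.ofReal (V y)) ∂P x + ENNReal.ofReal (φ (V x)) ≤
      ENNReal.ofReal (V x) + ENNReal.ofReal (V x) + ENNReal.ofReal |b| := by
  rw [lintegral_add_left h.measurable.ennreal_ofReal]
  refine le_trans ?_ ((h.lintegral_add_le x x).trans ?_)
  · gcongr
    have hx := h.one_le x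
    exact h.rate.monotoneOn (Set.mem_Ici.2 (by linarith)) (Set.mem_Ici.2 (by linarith))
      (by linarith)
  · gcongr
    exact Set.indicator_le_self' (fun _ _ => zero_le) _

end DoubleDrift

lemma lintegral_edist_eq_ofReal_integral_dist {E : Type*} [MetricSpace E]
    [SecondCountableTopology E] [MeasurableSpace E] [BorelSpace E] (hd : ∀ x y : E, dist x y ≤ 1)
    (μ : Measure (E × E)) [IsFiniteMeasure μ] :
    ∫⁻ w, edist w.1 w.2 ∂μ = ENNReal.ofReal (∫ w, dist w.1 w.2 ∂μ) := by
  have hint : Integrable (fun w : E × E => dist w.1 w.2) μ :=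
    Integrable.of_bound measurable_dist.aestronglyMeasurable 1
      (Eventually.of_forall fun w => by simpa using hd w.1 w.2)
  rw [ofReal_integral_eq_lintegral_ofReal hint (Eventually.of_forall fun w => dist_nonneg)]
  simp_rw [edist_dist]

lemma edist_le_one_of_dist_le_one {E : Type*} [PseudoMetricSpace E]
    (hd : ∀ x y : E, dist x y ≤ 1) (x y : E) : edist x y ≤ 1 := by
  rw [edist_dist]
  exact ENNReal.ofReal_le_one.2 (hd x y)

/-! ### Convergence of the coupled distance for the given kernels. -/

section Convergence

variable {E : Type*} [MetricSpace E] [SecondCountableTopology E] [MeasurableSpace E] [BorelSpace E]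
  {P : Kernel E E} {Q : Kernel (E × E) (E × E)} {Δ : Set (E × E)} {ℓ : ℕ} {ε : ℝ}
  {φ : ℝ → ℝ} {V : E → ℝ} {b : ℝ}

lemma ContractionCondition.lintegral_edist_le (hd : ∀ x y : E, dist x y ≤ 1)
    (hQ : IsCouplingKernel P Q) (hA1 : ContractionCondition Q Δ ℓ ε) (z : E × E) :
    ∫⁻ w, edist w.1 w.2 ∂Q z ≤ edist z.1 z.2 := by
  have := hQ.isMarkovKernel
  rw [lintegral_edist_eq_ofReal_integral_dist hd, edist_dist]
  exact ENNReal.ofReal_le_ofReal (hA1.weak_contraction z.1 z.2)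

lemma ContractionCondition.lintegral_pow_edist_le (hd : ∀ x y : E, dist x y ≤ 1)
    (hQ : IsCouplingKernel P Q) (hA1 : ContractionCondition Q Δ ℓ ε) {z : E × E} (hz : z ∈ Δ) :
    ∫⁻ w, edist w.1 w.2 ∂(Q ^ ℓ) z ≤ ENNReal.ofReal (1 - ε) * edist z.1 z.2 := by
  have := hQ.isMarkovKernel
  have := isMarkovKernel_pow Q ℓ
  rw [lintegral_edist_eq_ofReal_integral_dist hd, edist_dist, ← ENNReal.ofReal_mul' dist_nonneg]
  exact ENNReal.ofReal_le_ofReal (hA1.contraction z.1 z.2 hz)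

lemma DoubleDrift.exists_lintegral_pow_edist_le [IsMarkovKernel P] (hd : ∀ x y : E, dist x y ≤ 1)
    (hQ : IsCouplingKernel P Q) (hA1 : ContractionCondition Q Δ ℓ ε) (hA2 : DoubleDrift P Δ φ V b)
    {R : ℝ≥0∞} (hR : R ≠ ∞) {a : ℝ≥0∞} (ha : a ≠ 0) :
    ∃ n : ℕ, ∀ z : E × E, ENNReal.ofReal (V z.1) + ENNReal.ofReal (V z.2) ≤ R →
      ∫⁻ w, edist w.1 w.2 ∂(Q ^ n) z ≤ a := by
  have := hQ.isMarkovKernel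
  have hV : Measurable fun x => ENNReal.ofReal (V x) := hA2.measurable.ennreal_ofReal
  refine exists_lintegral_pow_le (d := fun w : E × E => edist w.1 w.2)
    (U := fun z => ENNReal.ofReal (V z.1) + ENNReal.ofReal (V z.2)) (Δ := Δ) (ℓ := ℓ)
    (r := ENNReal.ofReal (1 - ε)) (c := ENNReal.ofReal (φ 2)) (β := ENNReal.ofReal |b|)
    measurable_edist ((hV.comp measurable_fst).add (hV.comp measurable_snd))
    (fun z => edist_le_one_of_dist_le_one hd z.1 z.2) (hA1.lintegral_edist_le hd hQ)
    (ENNReal.ofReal_lt_one.2 (by linarith [hA1.eps_pos]))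
    (by simpa using hA2.rate.pos two_pos) ENNReal.ofReal_ne_top ENNReal.ofReal_ne_top
    (fun z hz => hA1.lintegral_pow_edist_le hd hQ hz) (fun z hz => ?_) (fun z => ?_) hR ha
  · simpa [hz] using hA2.lintegral_coupling_add_le hQ z
  · refine le_self_add.trans ((hA2.lintegral_coupling_add_le hQ z).trans ?_)
    gcongr
    exact Set.indicator_le_self' (fun _ _ => zero_le) _

lemma DoubleDrift.tendsto_lintegral_pow_edist [IsMarkovKernel P] (hd : ∀ x y : E, dist x y ≤ 1)
    (hQ : IsCouplingKernel P Q) (hA1 : ContractionCondition Q Δ ℓ ε) (hA2 : DoubleDrift P Δ φ V b)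
    (z : E × E) : Tendsto (fun n => ∫⁻ w, edist w.1 w.2 ∂(Q ^ n) z) atTop (𝓝 0) := by
  refine ENNReal.tendsto_nhds_zero.2 fun a ha => ?_
  obtain ⟨n, hn⟩ := hA2.exists_lintegral_pow_edist_le hd hQ hA1
    (R := ENNReal.ofReal (V z.1) + ENNReal.ofReal (V z.2)) (by finiteness) ha.ne'
  filter_upwards [eventually_ge_atTop n] with m hm
  exact (lintegral_pow_antitone measurable_edist (hA1.lintegral_edist_le hd hQ) z hm).trans
    (hn z le_rfl)

/-- Where `V y` is at most a suitable `R`, the uniform contraction gives the bound `a`. Beyond `R`,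
the rate exceeds `1 / a` and the trivial bound `d ≤ 1` is enough. -/
lemma DoubleDrift.exists_lintegral_pow_edist_le_rate [IsMarkovKernel P]
    (hd : ∀ x y : E, dist x y ≤ 1) (hQ : IsCouplingKernel P Q)
    (hA1 : ContractionCondition Q Δ ℓ ε) (hA2 : DoubleDrift P Δ φ V b)
    (x : E) {a : ℝ≥0∞} (ha : a ≠ 0) :
    ∃ n : ℕ, ∀ y, ∫⁻ w, edist w.1 w.2 ∂(Q ^ n) (y, x) ≤ a + a * ENNReal.ofReal (φ (V y)) := by
  have := hQ.isMarkovKernel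
  obtain ⟨N, hN⟩ := ENNReal.exists_nat_mul_gt ha ENNReal.one_ne_top
  obtain ⟨R, hR⟩ := eventually_atTop.1 (hA2.rate.tendsto_atTop.eventually_ge_atTop (N : ℝ))
  obtain ⟨n, hn⟩ := hA2.exists_lintegral_pow_edist_le hd hQ hA1
    (R := ENNReal.ofReal R + ENNReal.ofReal (V x)) (by finiteness) ha
  refine ⟨n, fun y => ?_⟩
  rcases le_total (V y) R with hy | hy
  · refine (hn (y, x) ?_).trans le_self_add
    gcongr
  · have := isMarkovKernel_pow Q n
    calc ∫⁻ w, edist w.1 w.2 ∂(Q ^ n) (y, x)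
        ≤ 1 := lintegral_le_of_le_const fun w => edist_le_one_of_dist_le_one hd w.1 w.2
      _ ≤ a * N := by rw [mul_comm]; exact hN.le
      _ ≤ a * ENNReal.ofReal (φ (V y)) := by
          gcongr
          rw [← ENNReal.ofReal_natCast]
          exact ENNReal.ofReal_le_ofReal (hR _ hy)
      _ ≤ _ := le_add_self

end Convergence

theorem mainTheorem2 {E : Type*} [MetricSpace E] [CompleteSpace E] [SecondCountableTopology E]
    [Nonempty E] [MeasurableSpace E] [BorelSpace E]
    (hd : ∀ x y : E, dist x y ≤ 1)
    (P : Kernel E E) [IsMarkovKernel P]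
    (Q : Kernel (E × E) (E × E)) (hQ : IsCouplingKernel P Q)
    (Δ : Set (E × E)) (ℓ : ℕ) (ε : ℝ) (hA1 : ContractionCondition Q Δ ℓ ε)
    (φ : ℝ → ℝ) (V : E → ℝ) (b : ℝ) (hA2 : DoubleDrift P Δ φ V b) :
    ∃ π : Measure E,
      (IsProbabilityMeasure π ∧ P.Invariant π) ∧
      (∀ π' : Measure E, IsProbabilityMeasure π' → P.Invariant π' → π' = π) ∧
      Integrable (fun x => φ (V x)) π := by
  obtain ⟨x⟩ := ‹Nonempty E›
  have hψ : Measurable fun x => ENNReal.ofReal (φ (V x)) := hA2.measurable_rate.ennreal_ofReal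
  have htight : IsTightMeasureSet (Set.range (cesaroMeasure P x)) :=
    isTightMeasureSet_range_cesaroMeasure hQ hψ
      (C := ENNReal.ofReal (V x) + ENNReal.ofReal (V x) + ENNReal.ofReal |b|) (by finiteness)
      (lintegral_cesaroMeasure_le_of_drift P hψ hA2.lintegral_add_rate_le x)
      (fun a ha => hA2.exists_lintegral_pow_edist_le_rate hd hQ hA1 x ha)
  obtain ⟨π, hπ, hinv⟩ := exists_invariant_of_isTightMeasureSet (P := P) (fun f hf L hL y z => by
    have h1 := hQ.lintegral_pow_le_add hf hL 1 y z
    rw [pow_one, pow_one] at h1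
    refine h1.trans ?_
    gcongr
    exact hA1.lintegral_edist_le hd hQ (y, z)) htight
  refine ⟨π, ⟨hπ, hinv⟩, fun π' hπ' hinv' => ?_, hA2.measurable_rate.aestronglyMeasurable, ?_⟩
  · exact invariant_unique hQ (edist_le_one_of_dist_le_one hd)
      (hA2.tendsto_lintegral_pow_edist hd hQ hA1) hinv' hinv
  · rw [hasFiniteIntegral_iff_ofReal (Eventually.of_forall fun x =>
      hA2.rate.nonneg _ (zero_le_one.trans (hA2.one_le x)))]
    have hV := hA2.measurable.ennreal_ofReal
    exact (Kernel.Invariant.lintegral_le_of_drift hinv (hV.add hV) hψ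
      (fun x => ENNReal.add_ne_top.2 ⟨ENNReal.ofReal_ne_top, ENNReal.ofReal_ne_top⟩)
      ENNReal.ofReal_ne_top hA2.lintegral_add_rate_le).trans_lt ENNReal.ofReal_lt_top
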